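/- Let $\mathbb{N}=\{1,2,3,\dots\}$. For $A\subseteq\mathbb{N}$ and $N\in\mathbb{N}$ put $\nu_N(A)=\frac1N\sum_{n=1}^N \mathbf 1_A(n)$. Let $\mathcal{F}$ be the collection of all $A\subseteq\mathbb{N}$ for which $\nu(A):=\lim_{N\to\infty}\nu_N(A)\in[0,1]$ exists, and let $\mathcal{N}=\{A\in\mathcal{F}:\nu(A)=0\}$ be the ideal of null sets. For $A\subseteq\mathbb{N}$ let $[A]$ be its class in the Boolean quotient $\mathcal{P}(\mathbb{N})/\mathcal{N}$, so that $[A]=[B]$ iff $A\triangle B\in\mathcal{N}$; the quotient is ordered by $[A]\le[B]$ iff $[A\cup B]=[B]$, and $[A]<[B]$ means $[A]\le[B]$ and $[A]\ne[B]$. For a collection $\mathcal{T}\subseteq\mathcal{P}(\mathbb{N})$ let $\mathcal{T}_*=\{\bigcup\mathcal{C}:\mathcal{C}\subseteq\mathcal{T}\}\cup\{\bigcap\mathcal{C}:\mathcal{C}\subseteq\mathcal{T}\}$. Here $\bigcup\emptyset=\emptyset$ and $\bigcap\emptyset=\mathbb{N}$, and suprema and infima of values of $\nu$ are taken in $[0,1]$,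 so $\sup\emptyset=0$ and $\inf\emptyset=1$. The symbol $\subset$ between sets of integers denotes strict inclusion. **Theorem.** Let $\mathcal{T}\subseteq\mathcal{F}$ be a chain, that is, totally ordered by inclusion. Then there exists a map $\phi:\mathcal{T}_*\cap\mathcal{F}\to\mathcal{F}$ such that: 1. for all $A\in\mathcal{T}_*\cap\mathcal{F}$, $\phi(A)\triangle A\in\mathcal{N}$; 2. for all $A,B\in\mathcal{T}_*\cap\mathcal{F}$, $[A]=[B]\iff\phi(A)=\phi(B)$, and $[A]<[B]\iff\phi(A)\subset\phi(B)$; 3. for all $\mathcal{S}\subseteq\mathcal{T}_*\cap\mathcal{F}$, (a) $\bigcup\phi(\mathcal{S})\in\mathcal{F}$ with $\nu(\bigcup\phi(\mathcal{S}))=\sup\{\nu(A):A\in\phi(\mathcal{S})\}$, and (b) $\bigcap\phi(\mathcal{S})\in\mathcal{F}$ with $\nu(\bigcap\phi(\mathcal{S}))=\inf\{\nu(A):A\in\phi(\mathcal{S})\}$; 4. every $A\in\phi(\mathcal{T}_*\cap\mathcal{F})_*$ belongs to $\mathcal{F}$ and satisfies $\nu_N(A)\le\nu(A)$ for all $N\in\mathbb{N}$;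 5. for every map $\rho:\mathcal{T}_*\cap\mathcal{F}\to\mathcal{F}$ such that $\rho(A)\triangle A\in\mathcal{N}$ for all $A\in\mathcal{T}_*\cap\mathcal{F}$, and every $\mathcal{S}\subseteq\mathcal{T}_*\cap\mathcal{F}$, (a) if $\bigcup\rho(\mathcal{S})\in\mathcal{F}$ with $\nu(\bigcup\rho(\mathcal{S}))=\sup\{\nu(A):A\in\rho(\mathcal{S})\}$, then $\left(\bigcup\phi(\mathcal{S})\right)\triangle\left(\bigcup\rho(\mathcal{S})\right)\in\mathcal{N}$, and (b) if $\bigcap\rho(\mathcal{S})\in\mathcal{F}$ with $\nu(\bigcap\rho(\mathcal{S}))=\inf\{\nu(A):A\in\rho(\mathcal{S})\}$, then $\left(\bigcap\phi(\mathcal{S})\right)\triangle\left(\bigcap\rho(\mathcal{S})\right)\in\mathcal{N}$. -/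

import Mathlib

open Filter Topology Set

namespace Cesaro

/-- The partial average `ν_N(A) = (1/N) ∑_{n=1}^N 1_A(n)` of a set of positive integers. -/
noncomputable def partialAverage (N : ℕ+) (A : Set ℕ+) : ℝ :=
  (1 / (N : ℝ)) * ∑ n ∈ Finset.Icc 1 N, A.indicator (fun _ => (1 : ℝ)) n

/-- The collection `𝓕` of the sets whose partial averages converge to a limit in `[0,1]`. -/
def limitSets : Set (Set ℕ+) :=
  {A | ∃ x : unitInterval, Tendsto (fun N => partialAverage N A) atTop (𝓝 (x : ℝ))}

/-- The Cesàro limit `ν : 𝓕 → [0,1]`. -/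
noncomputable def charge (A : limitSets) : unitInterval := A.2.choose

theorem tendsto_charge (A : limitSets) :
    Tendsto (fun N => partialAverage N A) atTop (𝓝 (charge A : ℝ)) :=
  A.2.choose_spec

/-- The null sets `𝓝 = {A ∈ 𝓕 : ν(A) = 0}`. -/
def nullSets : Set (Set ℕ+) :=
  {A | ∃ h : A ∈ limitSets, charge ⟨A, h⟩ = 0}

theorem partialAverage_nonneg (N : ℕ+) (A : Set ℕ+) : 0 ≤ partialAverage N A :=
  mul_nonneg (by positivity)
    (Finset.sum_nonneg fun _ _ => Set.indicator_nonneg (fun _ _ => zero_le_one) _)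

theorem partialAverage_mono (N : ℕ+) {A B : Set ℕ+} (h : A ⊆ B) :
    partialAverage N A ≤ partialAverage N B := by
  refine mul_le_mul_of_nonneg_left (Finset.sum_le_sum fun n _ => ?_) (by positivity)
  exact Set.indicator_le_indicator_of_subset h (fun _ => zero_le_one) n

theorem partialAverage_union_le (N : ℕ+) (A B : Set ℕ+) :
    partialAverage N (A ∪ B) ≤ partialAverage N A + partialAverage N B := by
  unfold partialAverage
  rw [← mul_add, ← Finset.sum_add_distrib]
  refine mul_le_mul_of_nonneg_left (Finset.sum_le_sum fun n _ => ?_) (by positivity)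
  by_cases h1 : n ∈ A <;> by_cases h2 : n ∈ B <;> simp [h1, h2]

theorem mem_nullSets_iff {A : Set ℕ+} :
    A ∈ nullSets ↔ Tendsto (fun N => partialAverage N A) atTop (𝓝 0) := by
  constructor
  · rintro ⟨h, h0⟩
    have := tendsto_charge ⟨A, h⟩
    rwa [h0] at this
  · intro h
    have hA : A ∈ limitSets := ⟨0, by simpa using h⟩
    exact ⟨hA, Subtype.ext (tendsto_nhds_unique (tendsto_charge ⟨A, hA⟩) h)⟩

theorem nullSets_subset {A B : Set ℕ+} (hB : B ∈ nullSets) (h : A ⊆ B) : A ∈ nullSets := by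
  rw [mem_nullSets_iff] at *
  exact squeeze_zero (fun N => partialAverage_nonneg N A) (fun N => partialAverage_mono N h) hB

theorem nullSets_union {A B : Set ℕ+} (hA : A ∈ nullSets) (hB : B ∈ nullSets) :
    A ∪ B ∈ nullSets := by
  rw [mem_nullSets_iff] at *
  refine squeeze_zero (fun N => partialAverage_nonneg N _)
    (fun N => partialAverage_union_le N A B) ?_
  simpa using hA.add hB

theorem empty_mem_nullSets : (∅ : Set ℕ+) ∈ nullSets := by
  rw [mem_nullSets_iff]
  simp [partialAverage]

/-- The equivalence relation `A ~ B ↔ A △ B ∈ 𝓝` on sets of positive integers. -/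
def nullSetoid : Setoid (Set ℕ+) where
  r A B := symmDiff A B ∈ nullSets
  iseqv :=
    { refl := fun A => by simpa using empty_mem_nullSets
      symm := fun {A B} h => by rwa [symmDiff_comm]
      trans := fun {A B C} h1 h2 =>
        nullSets_subset (nullSets_union h1 h2) (symmDiff_triangle A B C) }

/-- The quotient `𝓟(ℕ) / 𝓝`. -/
def NullQuotient : Type := Quotient nullSetoid

/-- The equivalence class `[A]`. -/
def cls (A : Set ℕ+) : NullQuotient := Quotient.mk nullSetoid A

theorem cls_eq_iff {A B : Set ℕ+} : cls A = cls B ↔ symmDiff A B ∈ nullSets :=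
  Quotient.eq (r := nullSetoid)

/-- The join `[A] ∨ [B] = [A ∪ B]`. -/
def NullQuotient.join : NullQuotient → NullQuotient → NullQuotient :=
  Quotient.map₂ (sa := nullSetoid) (sb := nullSetoid) (sc := nullSetoid) (fun A B => A ∪ B)
    (fun A₁ A₂ hA B₁ B₂ hB => by
      refine nullSets_subset (nullSets_union (A := symmDiff A₁ A₂) (B := symmDiff B₁ B₂) hA hB) ?_
      intro x hx
      simp only [Set.mem_symmDiff, Set.mem_union] at hx ⊢
      tauto)

theorem join_cls (A B : Set ℕ+) : NullQuotient.join (cls A) (cls B) = cls (A ∪ B) := rfl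

theorem join_eq_iff {A B : Set ℕ+} :
    NullQuotient.join (cls A) (cls B) = cls B ↔ A \ B ∈ nullSets := by
  have h : symmDiff (A ∪ B) B = A \ B := by
    ext x
    simp only [Set.mem_symmDiff, Set.mem_union, Set.mem_sdiff]
    tauto
  rw [join_cls, cls_eq_iff, h]

/-- The Boolean order of the quotient: `p ≤ q ↔ p ∨ q = q`. -/
instance : PartialOrder NullQuotient where
  le p q := NullQuotient.join p q = q
  le_refl p := by
    induction p using Quotient.inductionOn with
    | h A => exact join_eq_iff.2 (by simpa using empty_mem_nullSets)
  le_trans p q r := by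
    induction p using Quotient.inductionOn with
    | h A =>
      induction q using Quotient.inductionOn with
      | h B =>
        induction r using Quotient.inductionOn with
        | h C =>
          intro h1 h2
          refine join_eq_iff.2 (nullSets_subset
            (nullSets_union (join_eq_iff.1 h1) (join_eq_iff.1 h2)) ?_)
          intro x hx
          simp only [Set.mem_union, Set.mem_sdiff] at hx ⊢
          tauto
  le_antisymm p q := by
    induction p using Quotient.inductionOn with
    | h A =>
      induction q using Quotient.inductionOn with
      | h B =>
        intro h1 h2
        exact cls_eq_iff.2 (nullSets_union (join_eq_iff.1 h1) (join_eq_iff.1 h2))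

theorem cls_le_iff {A B : Set ℕ+} : cls A ≤ cls B ↔ A \ B ∈ nullSets :=
  join_eq_iff

/-- `𝒯_∪`, the unions of subcollections of `𝒯`; the union of the empty one is `∅`. -/
def unionClosure (T : Set (Set ℕ+)) : Set (Set ℕ+) := {A | ∃ C ⊆ T, A = ⋃₀ C}

/-- `𝒯_∩`, the intersections of subcollections of `𝒯`; that of the empty one is everything. -/
def interClosure (T : Set (Set ℕ+)) : Set (Set ℕ+) := {A | ∃ C ⊆ T, A = ⋂₀ C}

/-- `𝒯_* = 𝒯_∪ ∪ 𝒯_∩`. -/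
def starClosure (T : Set (Set ℕ+)) : Set (Set ℕ+) := unionClosure T ∪ interClosure T

end Cesaro

open Cesaro

namespace Cesaro

/-! Within a chain, the density of a set determines its class modulo null sets. So it suffices to
find one increasing family `E r`, `r ∈ [0,1]`, with `E r` of density `r`, all partial averages of `E
r` at most `r`, and `E (ν A)` equivalent to `A`; then `φ A = E (ν A)`. The bound on averages makes
`ν` continuous along the family: it passes to unions and intersections with `r` replaced by the
supremum or infimum, and monotonicity supplies the lower bound.

The family arises in two steps. In `exists_full_chain`, a maximal chain modulo null sets omits no
density, since a gap could be filled between the supremum of the sets below and the infimum of those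
above. In `exists_tame_chain`, the sets with rational density are made truly increasing by
`rectify`; a finite grid shows that their averages exceed their densities by uniformly little in the
long run, and delaying the entry of each integer absorbs this excess.

For item 5, a union or intersection that realizes the extremal density is determined modulo null
sets by the classes of its members. -/

/-! ### Densities and inclusion modulo null sets. -/

/-- `A` has Cesàro density `r`. -/
def HasDensity (A : Set ℕ+) (r : ℝ) : Prop :=
  Tendsto (fun N => partialAverage N A) atTop (𝓝 r)

theorem mem_nullSets_iff_hasDensity {A : Set ℕ+} : A ∈ nullSets ↔ HasDensity A 0 :=
  mem_nullSets_iff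

theorem partialAverage_le_of_forall {N : ℕ+} {A B : Set ℕ+} (h : ∀ n ≤ N, n ∈ A → n ∈ B) :
    partialAverage N A ≤ partialAverage N B := by
  refine mul_le_mul_of_nonneg_left (Finset.sum_le_sum fun n hn => ?_) (by positivity)
  have := h n (Finset.mem_Icc.1 hn).2
  by_cases hA : n ∈ A
  · simp [hA, this hA]
  · rw [Set.indicator_of_notMem hA]
    exact Set.indicator_nonneg (fun _ _ => zero_le_one) n

theorem partialAverage_univ (N : ℕ+) : partialAverage N univ = 1 := by
  simp [partialAverage]

theorem partialAverage_empty (N : ℕ+) : partialAverage N ∅ = 0 := by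
  simp [partialAverage]

theorem partialAverage_le_one (N : ℕ+) (A : Set ℕ+) : partialAverage N A ≤ 1 :=
  (partialAverage_mono N (subset_univ A)).trans_eq (partialAverage_univ N)

theorem partialAverage_union_of_disjoint (N : ℕ+) {A B : Set ℕ+} (h : Disjoint A B) :
    partialAverage N (A ∪ B) = partialAverage N A + partialAverage N B := by
  unfold partialAverage
  rw [← mul_add, ← Finset.sum_add_distrib, Set.indicator_union_of_disjoint h]

theorem partialAverage_add_sdiff (N : ℕ+) (A B : Set ℕ+) :
    partialAverage N A + partialAverage N (B \ A) = partialAverage N (A ∪ B) := by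
  rw [← partialAverage_union_of_disjoint N disjoint_sdiff_right, Set.union_sdiff_self]

theorem partialAverage_compl (N : ℕ+) (A : Set ℕ+) :
    partialAverage N Aᶜ = 1 - partialAverage N A := by
  rw [eq_sub_iff_add_eq', ← partialAverage_union_of_disjoint N disjoint_compl_right,
    Set.union_compl_self, partialAverage_univ]

theorem partialAverage_le_add_sdiff (N : ℕ+) (A B : Set ℕ+) :
    partialAverage N B ≤ partialAverage N A + partialAverage N (B \ A) :=
  (partialAverage_mono N subset_union_right).trans_eq (partialAverage_add_sdiff N A B).symm

theorem hasDensity_univ : HasDensity univ 1 := by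
  simp only [HasDensity, partialAverage_univ]
  exact tendsto_const_nhds

theorem hasDensity_empty : HasDensity ∅ 0 :=
  mem_nullSets_iff_hasDensity.1 empty_mem_nullSets

theorem HasDensity.mem_Icc {A : Set ℕ+} {r : ℝ} (h : HasDensity A r) : r ∈ Icc (0 : ℝ) 1 :=
  ⟨ge_of_tendsto' h fun N => partialAverage_nonneg N A,
    le_of_tendsto' h fun N => partialAverage_le_one N A⟩

theorem HasDensity.mem_limitSets {A : Set ℕ+} {r : ℝ} (h : HasDensity A r) : A ∈ limitSets :=
  ⟨⟨r, h.mem_Icc⟩, h⟩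

theorem HasDensity.charge_eq {A : Set ℕ+} {r : unitInterval} (h : HasDensity A r)
    (hA : A ∈ limitSets) : charge ⟨A, hA⟩ = r :=
  Subtype.ext (tendsto_nhds_unique (tendsto_charge ⟨A, hA⟩) h)

theorem HasDensity.compl {A : Set ℕ+} {r : ℝ} (h : HasDensity A r) : HasDensity Aᶜ (1 - r) := by
  simp only [HasDensity, partialAverage_compl]
  exact tendsto_const_nhds.sub h

theorem HasDensity.union_of_disjoint {A B : Set ℕ+} {a b : ℝ} (hA : HasDensity A a)
    (hB : HasDensity B b) (h : Disjoint A B) : HasDensity (A ∪ B) (a + b) := by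
  simp only [HasDensity, partialAverage_union_of_disjoint _ h]
  exact hA.add hB

/-- If `A ≤ B` modulo null sets, then `B \ A` has density `ν(B) - ν(A)`. -/
theorem HasDensity.sdiff {A B : Set ℕ+} {a b : ℝ} (hA : HasDensity A a) (hB : HasDensity B b)
    (h : A \ B ∈ nullSets) : HasDensity (B \ A) (b - a) := by
  have h1 : Tendsto (fun N => partialAverage N B + partialAverage N (A \ B) - partialAverage N A)
      atTop (𝓝 (b + 0 - a)) := (hB.add (mem_nullSets_iff.1 h)).sub hA
  rw [add_zero] at h1
  refine h1.congr fun N => ?_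
  rw [partialAverage_add_sdiff, Set.union_comm, ← partialAverage_add_sdiff]
  ring

theorem sdiff_trans_mem_nullSets {A B C : Set ℕ+} (h1 : A \ B ∈ nullSets)
    (h2 : B \ C ∈ nullSets) : A \ C ∈ nullSets :=
  cls_le_iff.1 ((cls_le_iff.2 h1).trans (cls_le_iff.2 h2))

theorem sdiff_mem_nullSets_of_subset {A B : Set ℕ+} (h : A ⊆ B) : A \ B ∈ nullSets := by
  rw [Set.sdiff_eq_empty.2 h]
  exact empty_mem_nullSets

theorem HasDensity.le {A B : Set ℕ+} {a b : ℝ} (hA : HasDensity A a) (hB : HasDensity B b)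
    (h : A \ B ∈ nullSets) : a ≤ b :=
  sub_nonneg.1 (hA.sdiff hB h).mem_Icc.1

/-- Comparable sets are ordered as their densities. -/
theorem HasDensity.sdiff_mem_nullSets {A B : Set ℕ+} {a b : ℝ} (hA : HasDensity A a)
    (hB : HasDensity B b) (hab : a ≤ b) (h : A \ B ∈ nullSets ∨ B \ A ∈ nullSets) :
    A \ B ∈ nullSets := by
  refine h.elim id fun h => ?_
  rw [mem_nullSets_iff_hasDensity, ← sub_eq_zero.2 (hab.antisymm (hB.le hA h))]
  exact hB.sdiff hA h

theorem HasDensity.congr {A B : Set ℕ+} {a : ℝ} (hA : HasDensity A a) (h1 : A \ B ∈ nullSets)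
    (h2 : B \ A ∈ nullSets) : HasDensity B a := by
  have h : Tendsto (fun N => partialAverage N A + partialAverage N (B \ A) -
      partialAverage N (A \ B)) atTop (𝓝 (a + 0 - 0)) :=
    (hA.add (mem_nullSets_iff.1 h2)).sub (mem_nullSets_iff.1 h1)
  rw [add_zero, sub_zero] at h
  refine h.congr fun N => ?_
  rw [partialAverage_add_sdiff, Set.union_comm, ← partialAverage_add_sdiff]
  ring

theorem HasDensity.eventually_le {A : Set ℕ+} {a b : ℝ} (hA : HasDensity A a) (h : a < b) :
    ∀ᶠ N in atTop, partialAverage N A ≤ b :=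
  (hA.eventually_lt_const h).mono fun _ => le_of_lt

theorem mem_nullSets_of_forall_pos {X : Set ℕ+}
    (h : ∀ ε > 0, ∃ Y y, HasDensity Y y ∧ y < ε ∧ X \ Y ∈ nullSets) : X ∈ nullSets := by
  rw [mem_nullSets_iff, tendsto_order]
  refine ⟨fun a ha => .of_forall fun N => ha.trans_le (partialAverage_nonneg N X), fun ε hε => ?_⟩
  obtain ⟨Y, y, hY, hy, hXY⟩ := h ε hε
  have h1 : Tendsto (fun N => partialAverage N Y + partialAverage N (X \ Y)) atTop
    (𝓝 (y + 0)) := hY.add (mem_nullSets_iff.1 hXY)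
  rw [add_zero] at h1
  filter_upwards [h1.eventually_lt_const hy] with N hN
  exact (partialAverage_le_add_sdiff N Y X).trans_lt hN

/-- The hypotheses are asymmetric because the sets almost contained in `A` bound its averages only
from below; the upper bound is where countable unions can fail. -/
theorem hasDensity_of_forall_pos {A : Set ℕ+} {r : ℝ}
    (h1 : ∀ ε > 0, ∃ X x, HasDensity X x ∧ r - ε < x ∧ X \ A ∈ nullSets)
    (h2 : ∀ ε > 0, ∀ᶠ N in atTop, partialAverage N A ≤ r + ε) : HasDensity A r := by
  refine tendsto_order.2 ⟨fun a ha => ?_, fun a ha => ?_⟩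
  · obtain ⟨X, x, hX, hx, hXA⟩ := h1 (r - a) (sub_pos.2 ha)
    have h : Tendsto (fun N => partialAverage N X - partialAverage N (X \ A)) atTop
      (𝓝 (x - 0)) := hX.sub (mem_nullSets_iff.1 hXA)
    rw [sub_zero] at h
    filter_upwards [h.eventually_const_lt (show a < x by linarith)] with N hN
    linarith [partialAverage_le_add_sdiff N A X]
  · filter_upwards [h2 ((a - r) / 2) (by linarith)] with N hN
    linarith

theorem tendsto_const_div_pnat (c : ℝ) : Tendsto (fun N : ℕ+ => c / (N : ℝ)) atTop (𝓝 0) :=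
  tendsto_const_nhds.div_atTop (tendsto_natCast_atTop_atTop.comp tendsto_PNat_val_atTop_atTop)

theorem mem_nullSets_of_forall_lt {A : Set ℕ+} (m : ℕ) (h : ∀ n ∈ A, (n : ℕ) < m) :
    A ∈ nullSets := by
  rw [mem_nullSets_iff]
  refine squeeze_zero (fun N => partialAverage_nonneg N A) (fun N => ?_)
    (tendsto_const_div_pnat m)
  rw [partialAverage, one_div, inv_mul_eq_div]
  refine div_le_div_of_nonneg_right ?_ (by positivity)
  classical
  simp only [Set.indicator_apply]
  rw [Finset.sum_boole, Nat.cast_le]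
  calc _ ≤ (Finset.range m).card := Finset.card_le_card_of_injOn (fun n : ℕ+ => (n : ℕ))
        (fun n hn => by
          have hn := (Finset.mem_filter.1 hn).2
          simpa using h n hn) PNat.coe_injective.injOn
    _ = m := Finset.card_range m

/-! ### Pseudo-unions of increasing sequences. -/

/-- An increasing sequence of sets has a pseudo-union whose density is the limit. -/
theorem exists_hasDensity_of_monotone {L : ℕ → Set ℕ+} {a : ℕ → ℝ} {s : ℝ} (hL : Monotone L)
    (hd : ∀ i, HasDensity (L i) (a i)) (has : ∀ i, a i ≤ s) (ha : Tendsto a atTop (𝓝 s)) :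
    ∃ C, HasDensity C s ∧ ∀ i, L i \ C ∈ nullSets := by
  obtain ⟨m, hm, hmL⟩ := extraction_forall_of_eventually'
    (P := fun i n => ∀ N : ℕ+, n ≤ (N : ℕ) → partialAverage N (L i) ≤ s + 1 / ((i : ℝ) + 1))
    fun i => by
      obtain ⟨M, hM⟩ := eventually_atTop.1 ((hd i).eventually_le
        (show a i < s + 1 / ((i : ℝ) + 1) from
          (has i).trans_lt (lt_add_of_pos_right s Nat.one_div_pos_of_nat)))
      exact ⟨M, fun k hk N hN => hM N (PNat.coe_le_coe _ _ |>.1 (hk.le.trans hN))⟩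
  -- Each `L i` loses only finitely many elements, and up to `N` the set `C` lies in `L i` for the
  -- last `i` with `m i ≤ N`, whose average at `N` is already controlled.
  set C : Set ℕ+ := {n | ∃ i, m i ≤ (n : ℕ) ∧ n ∈ L i}
  have hLC : ∀ i, L i \ C ∈ nullSets := fun i => by
    refine mem_nullSets_of_forall_lt (m i) fun n hn => ?_
    by_contra! h
    exact hn.2 ⟨i, h, hn.1⟩
  refine ⟨C, hasDensity_of_forall_pos (fun ε hε => ?_) fun ε hε => ?_, hLC⟩
  · obtain ⟨i, hi⟩ := (ha.eventually_const_lt (sub_lt_self s hε)).exists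
    exact ⟨L i, a i, hd i, hi, hLC i⟩
  · obtain ⟨k, hk⟩ := exists_nat_one_div_lt hε
    have hev : ∀ᶠ N : ℕ+ in atTop, m k ≤ (N : ℕ) :=
      tendsto_PNat_val_atTop_atTop.eventually_ge_atTop (m k)
    filter_upwards [hev] with N hN
    -- Searching up to `N` suffices since `j ≤ m j`; the index `k` qualifies, so the result is not a
    -- mere default.
    set i := Nat.findGreatest (fun i => m i ≤ (N : ℕ)) N
    have hle : ∀ j, m j ≤ (N : ℕ) → j ≤ i := fun j hj =>
      Nat.le_findGreatest ((hm.id_le j).trans hj) hj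
    have hi : m i ≤ (N : ℕ) :=
      Nat.findGreatest_spec (P := fun i => m i ≤ (N : ℕ)) ((hm.id_le k).trans hN) hN
    calc partialAverage N C ≤ partialAverage N (L i) := by
          refine partialAverage_le_of_forall fun n hn ⟨j, hj, hnj⟩ => ?_
          exact hL (hle j (hj.trans hn)) hnj
      _ ≤ s + 1 / ((i : ℝ) + 1) := hmL i N hi
      _ ≤ s + 1 / ((k : ℝ) + 1) := by
          gcongr
          exact hle k hN
      _ ≤ s + ε := by linarith

/-! ### Subsets of prescribed density and interpolation. -/

/-- The number of elements of `D` up to `N`, as a real number. -/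
noncomputable def count (D : Set ℕ+) (N : ℕ+) : ℝ :=
  ∑ n ∈ Finset.Icc 1 N, D.indicator (fun _ => (1 : ℝ)) n

theorem count_one (D : Set ℕ+) : count D 1 = D.indicator (fun _ => (1 : ℝ)) 1 := by
  simp [count]

theorem count_add_one (D : Set ℕ+) (N : ℕ+) :
    count D (N + 1) = count D N + D.indicator (fun _ => (1 : ℝ)) (N + 1) := by
  have h : Finset.Icc 1 (N + 1) = insert (N + 1) (Finset.Icc 1 N) := by
    ext n
    simp only [Finset.mem_Icc, Finset.mem_insert, one_le, true_and]
    rw [← PNat.coe_le_coe, ← PNat.coe_le_coe, ← PNat.coe_inj, PNat.add_coe]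
    simp only [PNat.one_coe]
    omega
  rw [count, h, Finset.sum_insert, add_comm]
  · rfl
  · simp

theorem partialAverage_eq_count_div (D : Set ℕ+) (N : ℕ+) :
    partialAverage N D = count D N / N := by
  rw [partialAverage, one_div, inv_mul_eq_div, count]

theorem floor_sub_floor_eq_indicator {l x : ℝ} (h0 : 0 ≤ l) (h1 : l ≤ 1) :
    (⌊l * (x + 1)⌋ : ℝ) = ⌊l * x⌋ + if ⌊l * x⌋ < ⌊l * (x + 1)⌋ then (1 : ℝ) else 0 := by
  have hle : ⌊l * x⌋ ≤ ⌊l * (x + 1)⌋ := Int.floor_le_floor (by nlinarith)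
  have hlt : ⌊l * (x + 1)⌋ ≤ ⌊l * x⌋ + 1 := by
    rw [← Int.floor_add_one]
    exact Int.floor_le_floor (by nlinarith)
  split_ifs with h
  · rw [show ⌊l * (x + 1)⌋ = ⌊l * x⌋ + 1 by omega]
    push_cast
    rfl
  · rw [show ⌊l * (x + 1)⌋ = ⌊l * x⌋ by omega, add_zero]

/-- A set with a density has subsets of every smaller density. -/
theorem HasDensity.exists_subset {D : Set ℕ+} {d l : ℝ} (hD : HasDensity D d) (h0 : 0 ≤ l)
    (h1 : l ≤ 1) : ∃ C ⊆ D, HasDensity C (l * d) := by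
  classical
  -- An element of `D` is kept exactly when it makes `⌊l * count D⌋` jump; `count D n - 1` is the
  -- count just before `n`.
  set C : Set ℕ+ := {n | n ∈ D ∧ ⌊l * (count D n - 1)⌋ < ⌊l * count D n⌋}
  have hCD : C ⊆ D := fun n hn => hn.1
  have hC : ∀ N, count C N = ⌊l * count D N⌋ := by
    have key : ∀ N (x : ℝ), count D N = x + D.indicator (fun _ => (1 : ℝ)) N →
        (⌊l * x⌋ : ℝ) + C.indicator (fun _ => (1 : ℝ)) N = ⌊l * count D N⌋ := by
      intro N x hN
      by_cases h : N ∈ D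
      · rw [Set.indicator_of_mem h] at hN
        have hmem : N ∈ C ↔ ⌊l * x⌋ < ⌊l * (x + 1)⌋ := by
          simp only [C, Set.mem_ofPred_eq, h, true_and, hN, add_sub_cancel_right]
        rw [hN, floor_sub_floor_eq_indicator h0 h1, Set.indicator_apply]
        simp only [hmem]
      · rw [Set.indicator_of_notMem h, add_zero] at hN
        rw [Set.indicator_of_notMem fun h' => h (hCD h'), add_zero, hN]
    intro N
    induction N using PNat.recOn with
    | one =>
      rw [← key 1 0 (by rw [count_one, zero_add]), count_one]
      simp
    | succ N ih => rw [count_add_one, ih, key _ _ (count_add_one D N)]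
  refine ⟨C, hCD, ?_⟩
  have hlim : Tendsto (fun N => l * partialAverage N D - 1 / (N : ℝ)) atTop (𝓝 (l * d - 0)) :=
    (hD.const_mul l).sub (tendsto_const_div_pnat 1)
  rw [sub_zero] at hlim
  refine tendsto_of_tendsto_of_tendsto_of_le_of_le hlim (hD.const_mul l) (fun N => ?_) fun N => ?_
  · have hN : (0 : ℝ) < N := by exact_mod_cast N.pos
    simp only [partialAverage_eq_count_div, hC]
    rw [← mul_div_assoc, ← sub_div]
    gcongr
    exact (Int.sub_one_lt_floor _).le
  · simp only [partialAverage_eq_count_div, hC]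
    rw [← mul_div_assoc]
    gcongr
    exact Int.floor_le _

/-- Interpolation of densities between comparable sets. -/
theorem exists_hasDensity_between {A B : Set ℕ+} {a b t : ℝ} (hA : HasDensity A a)
    (hB : HasDensity B b) (h : A \ B ∈ nullSets) (hat : a ≤ t) (htb : t ≤ b) :
    ∃ C, HasDensity C t ∧ A \ C ∈ nullSets ∧ C \ B ∈ nullSets := by
  have hl : ∃ l : ℝ, 0 ≤ l ∧ l ≤ 1 ∧ a + l * (b - a) = t := by
    rcases hat.eq_or_lt with rfl | hat
    · exact ⟨0, le_rfl, zero_le_one, by ring⟩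
    · have : 0 < b - a := by linarith
      refine ⟨(t - a) / (b - a), div_nonneg (by linarith) this.le,
        (div_le_one this).2 (by linarith), ?_⟩
      rw [div_mul_cancel₀ _ this.ne']
      ring
  obtain ⟨l, h0, h1, rfl⟩ := hl
  obtain ⟨C, hC, hCd⟩ := (hA.sdiff hB h).exists_subset h0 h1
  refine ⟨A ∪ C, hA.union_of_disjoint hCd (disjoint_sdiff_right.mono_right hC),
    sdiff_mem_nullSets_of_subset subset_union_left, nullSets_subset h ?_⟩
  rintro n ⟨hn | hn, hnB⟩
  · exact ⟨hn, hnB⟩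
  · exact absurd (hC hn).1 hnB

/-! ### Suprema and infima modulo null sets. -/

theorem biUnion_mem_nullSets {ι : Type*} {s : Set ι} (hs : s.Finite) {A : ι → Set ℕ+}
    (h : ∀ i ∈ s, A i ∈ nullSets) : ⋃ i ∈ s, A i ∈ nullSets := by
  induction s, hs using Set.Finite.induction_on with
  | empty => simpa using empty_mem_nullSets
  | insert _ _ ih =>
    rw [Set.biUnion_insert]
    exact nullSets_union (h _ (mem_insert _ _)) (ih fun i hi => h i (mem_insert_of_mem _ hi))

/-- A family of pairwise comparable sets has a supremum modulo null sets, whose density is the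
supremum of the densities. -/
theorem exists_sup_of_comparable {ι : Type*} [Nonempty ι] {A : ι → Set ℕ+} {a : ι → ℝ} {s : ℝ}
    (hd : ∀ i, HasDensity (A i) (a i))
    (hc : ∀ i j, A i \ A j ∈ nullSets ∨ A j \ A i ∈ nullSets) (hs : IsLUB (range a) s) :
    ∃ C, HasDensity C s ∧ (∀ i, A i \ C ∈ nullSets) ∧
      ∀ B, (∀ i, A i \ B ∈ nullSets) → C \ B ∈ nullSets := by
  have hle : ∀ i j, a i ≤ a j → A i \ A j ∈ nullSets := fun i j h =>
    (hd i).sdiff_mem_nullSets (hd j) h (hc i j)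
  obtain ⟨u, hu, hlim, hmem⟩ := exists_seq_tendsto_sSup (range_nonempty a) hs.bddAbove
  rw [hs.csSup_eq (range_nonempty a)] at hlim
  choose f hf using hmem
  -- Finite accumulation makes the sequence truly increasing at the cost of finitely many null sets.
  have hnull : ∀ i, Set.accumulate (fun j => A (f j)) i \ A (f i) ∈ nullSets := fun i => by
    simp only [Set.accumulate_def, Set.iUnion_sdiff]
    refine biUnion_mem_nullSets (Set.finite_Iic i) fun j hj => hle _ _ ?_
    rw [hf, hf]
    exact hu hj
  obtain ⟨C, hC, hLC⟩ := exists_hasDensity_of_monotone (L := Set.accumulate fun j => A (f j))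
    (a := u) Set.monotone_accumulate
    (fun i => hf i ▸ (hd (f i)).congr
      (sdiff_mem_nullSets_of_subset
        (Set.subset_accumulate (s := fun j => A (f j)) (x := i))) (hnull i))
    (fun i => hs.1 ⟨f i, hf i⟩) hlim
  have hAC : ∀ i, A (f i) \ C ∈ nullSets := fun i =>
    nullSets_subset (hLC i) (sdiff_le_sdiff_right
      (Set.subset_accumulate (s := fun j => A (f j)) (x := i)))
  -- Both claims use an `A (f k)` of density above `s - ε`: what `A i` or `C` has outside it has
  -- density below `ε`, unless `A i` is almost contained in it.
  refine ⟨C, hC, fun i => mem_nullSets_of_forall_pos fun ε hε => ?_, fun B hB =>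
    mem_nullSets_of_forall_pos fun ε hε => ?_⟩
  · obtain ⟨k, hk⟩ := (hlim.eventually_const_lt (sub_lt_self s hε)).exists
    rcases le_total (a i) (a (f k)) with h | h
    · exact ⟨∅, 0, hasDensity_empty, hε, by
        simpa using sdiff_trans_mem_nullSets (hle _ _ h) (hAC k)⟩
    · refine ⟨A i \ A (f k), _, (hd _).sdiff (hd i) (hle _ _ h), ?_, nullSets_subset (hAC k) ?_⟩
      · have := hs.1 ⟨i, rfl⟩
        rw [hf]
        linarith
      · rintro n ⟨⟨h1, h2⟩, h3⟩
        exact ⟨by_contra fun h => h3 ⟨h1, h⟩, h2⟩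
  · obtain ⟨k, hk⟩ := (hlim.eventually_const_lt (sub_lt_self s hε)).exists
    refine ⟨C \ A (f k), _, (hd _).sdiff hC (hAC k), ?_, nullSets_subset (hB (f k)) ?_⟩
    · rw [hf]
      linarith
    · rintro n ⟨⟨h1, h2⟩, h3⟩
      exact ⟨by_contra fun h => h3 ⟨h1, h⟩, h2⟩

theorem exists_inf_of_comparable {ι : Type*} [Nonempty ι] {A : ι → Set ℕ+} {a : ι → ℝ} {s : ℝ}
    (hd : ∀ i, HasDensity (A i) (a i))
    (hc : ∀ i j, A i \ A j ∈ nullSets ∨ A j \ A i ∈ nullSets) (hs : IsGLB (range a) s) :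
    ∃ C, HasDensity C s ∧ (∀ i, C \ A i ∈ nullSets) ∧
      ∀ B, (∀ i, B \ A i ∈ nullSets) → B \ C ∈ nullSets := by
  have hs' : IsLUB (range fun i => 1 - a i) (1 - s) := by
    refine ⟨?_, fun b hb => ?_⟩
    · rintro _ ⟨i, rfl⟩
      exact sub_le_sub_left (hs.1 ⟨i, rfl⟩) 1
    · have : 1 - b ≤ s := hs.2 (by
        rintro _ ⟨i, rfl⟩
        have : 1 - a i ≤ b := hb ⟨i, rfl⟩
        linarith)
      linarith
  obtain ⟨C, hC, h1, h2⟩ := exists_sup_of_comparable (A := fun i => (A i)ᶜ)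
    (fun i => (hd i).compl) (fun i j => by simpa only [compl_sdiff_compl] using (hc i j).symm) hs'
  refine ⟨Cᶜ, by simpa using hC.compl, fun i => ?_, fun B hB => ?_⟩
  · rw [← compl_compl (A i), compl_sdiff_compl]
    exact h1 i
  · rw [← compl_compl B, compl_sdiff_compl]
    exact h2 _ fun i => by simpa only [compl_sdiff_compl] using hB i

/-! ### A maximal chain takes every density. -/

/-- Every chain of sets with a density is, modulo null sets, part of a chain that takes every
density exactly once. -/
theorem exists_full_chain {U : Set (Set ℕ+)} (hU : U ⊆ limitSets) (hc : IsChain (· ⊆ ·) U) :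
    ∃ C : unitInterval → Set ℕ+, (∀ t, HasDensity (C t) t) ∧
      (∀ s t, s ≤ t → C s \ C t ∈ nullSets) ∧
      ∀ A ∈ U, ∀ t : unitInterval, HasDensity A t → A \ C t ∈ nullSets := by
  let r : limitSets → limitSets → Prop := fun A B => (A : Set ℕ+) \ B ∈ nullSets
  -- The sets `∅` and `univ` ensure that there are sets on both sides of a missing density.
  have hchain : IsChain r {A | (A : Set ℕ+) ∈ insert ∅ (insert univ U)} := by
    have : IsChain (· ⊆ ·) (insert ∅ (insert univ U)) :=
      (hc.insert fun b _ _ => .inr (subset_univ b)).insert fun b _ _ => .inl (empty_subset b)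
    intro A hA B hB hAB
    exact (this hA hB (Subtype.coe_ne_coe.2 hAB)).imp sdiff_mem_nullSets_of_subset
      sdiff_mem_nullSets_of_subset
  obtain ⟨M, hM, hUM⟩ := hchain.exists_maxChain
  have hcomp : ∀ A ∈ M, ∀ B ∈ M,
      (A : Set ℕ+) \ B ∈ nullSets ∨ (B : Set ℕ+) \ A ∈ nullSets := fun A hA B hB => by
    by_cases h : A = B
    · subst h
      exact .inl (sdiff_mem_nullSets_of_subset subset_rfl)
    · exact hM.1 hA hB h
  have hle : ∀ A ∈ M, ∀ B ∈ M, charge A ≤ charge B → (A : Set ℕ+) \ B ∈ nullSets :=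
    fun A hA B hB h => HasDensity.sdiff_mem_nullSets (tendsto_charge A) (tendsto_charge B) h
      (hcomp A hA B hB)
  have hfull : ∀ t : unitInterval, ∃ A ∈ M, charge A = t := by
    intro t
    by_contra! hne
    have hbot : (⟨∅, hasDensity_empty.mem_limitSets⟩ : limitSets) ∈ M := hUM (mem_insert _ _)
    have htop : (⟨univ, hasDensity_univ.mem_limitSets⟩ : limitSets) ∈ M :=
      hUM (mem_insert_of_mem _ (mem_insert _ _))
    let I := {A : limitSets // A ∈ M ∧ charge A < t}
    let J := {A : limitSets // A ∈ M ∧ t < charge A}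
    have : Nonempty I := ⟨⟨_, hbot, lt_of_le_of_ne (by
      rw [HasDensity.charge_eq (r := 0) (by simpa using hasDensity_empty)]
      exact unitInterval.nonneg') (hne _ hbot)⟩⟩
    have : Nonempty J := ⟨⟨_, htop, lt_of_le_of_ne (by
      rw [HasDensity.charge_eq (r := 1) (by simpa using hasDensity_univ)]
      exact unitInterval.le_one') (hne _ htop).symm⟩⟩
    let a : I → ℝ := fun A => charge A.1
    let b : J → ℝ := fun A => charge A.1
    have ha : ∀ A, a A ≤ t := fun A => A.2.2.le
    have hb : ∀ A, (t : ℝ) ≤ b A := fun A => A.2.2.le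
    obtain ⟨C₁, hC₁, hIC, hC₁'⟩ := exists_sup_of_comparable (A := fun A : I => (A.1 : Set ℕ+))
      (a := a) (fun A => tendsto_charge A.1) (fun A B => hcomp _ A.2.1 _ B.2.1)
      (isLUB_csSup (range_nonempty a) ⟨t, forall_mem_range.2 ha⟩)
    obtain ⟨C₂, hC₂, hJC, hC₂'⟩ := exists_inf_of_comparable (A := fun A : J => (A.1 : Set ℕ+))
      (a := b) (fun A => tendsto_charge A.1) (fun A B => hcomp _ A.2.1 _ B.2.1)
      (isGLB_csInf (range_nonempty b) ⟨t, forall_mem_range.2 hb⟩)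
    -- A set of the missing density `t` between the two halves is comparable with all of `M`,
    -- against maximality.
    obtain ⟨D, hD, h1, h2⟩ := exists_hasDensity_between hC₁ hC₂
      (hC₂' _ fun B => hC₁' _ fun A => hle _ A.2.1 _ B.2.1 (A.2.2.trans B.2.2).le)
      (csSup_le (range_nonempty a) (forall_mem_range.2 ha))
      (le_csInf (range_nonempty b) (forall_mem_range.2 hb))
    have hins : IsChain r (insert ⟨D, hD.mem_limitSets⟩ M) := hM.1.insert fun B hB _ => by
      rcases (hne B hB).lt_or_gt with h | h
      · exact .inr (sdiff_trans_mem_nullSets (hIC ⟨B, hB, h⟩) h1)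
      · exact .inl (sdiff_trans_mem_nullSets h2 (hJC ⟨B, hB, h⟩))
    have hDM : (⟨D, hD.mem_limitSets⟩ : limitSets) ∈ M := by
      rw [hM.2 hins (subset_insert _ _)]
      exact mem_insert _ _
    exact hne _ hDM (hD.charge_eq _)
  choose C hCM hC using hfull
  refine ⟨fun t => C t, fun t => ?_, fun s t h => hle _ (hCM s) _ (hCM t) (by rwa [hC, hC]),
    fun A hA t ht => hle ⟨A, hU hA⟩ (hUM (mem_insert_of_mem _ (mem_insert_of_mem _ hA))) _ (hCM t)
      (by rw [hC, ht.charge_eq])⟩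
  have := tendsto_charge (C t)
  rwa [hC] at this

/-! ### From a chain modulo null sets to a tame chain. -/

/-- The modification of a sequence of sets that is increasing in the labels `q` modulo null sets
into one that is truly increasing in the labels. -/
def rectify (C : ℕ → Set ℕ+) (q : ℕ → ℝ) : ℕ → Set ℕ+
  | n => {x | (x ∈ C n ∨ ∃ i : Fin n, q i ≤ q n ∧ x ∈ rectify C q i) ∧
      ∀ i : Fin n, q n ≤ q i → x ∈ rectify C q i}

theorem mem_rectify {C : ℕ → Set ℕ+} {q : ℕ → ℝ} {n : ℕ} {x : ℕ+} :
    x ∈ rectify C q n ↔ (x ∈ C n ∨ ∃ i < n, q i ≤ q n ∧ x ∈ rectify C q i) ∧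
      ∀ i < n, q n ≤ q i → x ∈ rectify C q i := by
  rw [rectify]
  simp only [Set.mem_ofPred_eq, Fin.exists_iff, Fin.forall_iff, exists_prop]

theorem rectify_subset {C : ℕ → Set ℕ+} {q : ℕ → ℝ} {i j : ℕ} (h : q i ≤ q j) :
    rectify C q i ⊆ rectify C q j := by
  induction hn : max i j using Nat.strong_induction_on generalizing i j with
  | _ n ih =>
    rcases lt_trichotomy i j with hij | rfl | hij
    · intro x hx
      refine mem_rectify.2 ⟨.inr ⟨i, hij, h, hx⟩, fun k hk hjk => ?_⟩
      -- Both `i` and `k` are below `j`, so the maximum drops.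
      exact ih (max i k) (by omega) (h.trans hjk) rfl hx
    · exact subset_rfl
    · exact fun x hx => (mem_rectify.1 hx).2 j hij h

/-- Stage `n` involves only finitely many earlier sets, each changing `C n` by a null set. This is
why the labels are a sequence and not all of `[0,1]`. -/
theorem rectify_equiv {C : ℕ → Set ℕ+} {q : ℕ → ℝ} (hC : ∀ i j, q i ≤ q j → C i \ C j ∈ nullSets)
    (n : ℕ) : rectify C q n \ C n ∈ nullSets ∧ C n \ rectify C q n ∈ nullSets := by
  induction n using Nat.strong_induction_on with
  | _ n ih =>
    have hfin : ∀ p : ℕ → Prop, {i | i < n ∧ p i}.Finite := fun p =>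
      (Set.finite_Iio n).subset fun i hi => hi.1
    constructor
    · refine nullSets_subset (biUnion_mem_nullSets (hfin fun i => q i ≤ q n)
        (A := fun i => rectify C q i \ C n) fun i hi =>
          sdiff_trans_mem_nullSets (ih i hi.1).1 (hC i n hi.2)) ?_
      rintro x ⟨hx, hxn⟩
      obtain ⟨i, hi, hq, hxi⟩ := (mem_rectify.1 hx).1.resolve_left hxn
      exact Set.mem_biUnion (show i ∈ {i | i < n ∧ q i ≤ q n} from ⟨hi, hq⟩) ⟨hxi, hxn⟩
    · refine nullSets_subset (biUnion_mem_nullSets (hfin fun i => q n ≤ q i)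
        (A := fun i => C n \ rectify C q i) fun i hi =>
          sdiff_trans_mem_nullSets (hC n i hi.2) (ih i hi.1).2) ?_
      rintro x ⟨hx, hxn⟩
      rw [mem_rectify] at hxn
      push Not at hxn
      obtain ⟨i, hi, hq, hxi⟩ := hxn (.inl hx)
      exact Set.mem_biUnion (show i ∈ {i | i < n ∧ q n ≤ q i} from ⟨hi, hq⟩) ⟨hx, hxi⟩

theorem exists_enumeration_rat_unitInterval :
    ∃ q : ℕ → unitInterval, ∀ x : ℚ, 0 ≤ x → x ≤ 1 → ∃ j, (q j : ℝ) = x := by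
  have : Nonempty {x : ℚ // 0 ≤ x ∧ x ≤ 1} := ⟨⟨0, le_rfl, zero_le_one⟩⟩
  obtain ⟨f, hf⟩ := exists_surjective_nat {x : ℚ // 0 ≤ x ∧ x ≤ 1}
  refine ⟨fun n => ⟨(f n).1, by exact_mod_cast (f n).2.1, by exact_mod_cast (f n).2.2⟩,
    fun x h0 h1 => ?_⟩
  obtain ⟨j, hj⟩ := hf ⟨x, h0, h1⟩
  exact ⟨j, by simp [hj]⟩

/-- The partial averages of a chain of sets with densities exceed the densities by uniformly
little. -/
theorem eventually_forall_partialAverage_le {q : ℕ → unitInterval} {R : ℕ → Set ℕ+}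
    (hq : ∀ x : ℚ, 0 ≤ x → x ≤ 1 → ∃ j, (q j : ℝ) = x)
    (hR : ∀ i j, (q i : ℝ) ≤ q j → R i ⊆ R j) (hd : ∀ i, HasDensity (R i) (q i)) {d : ℝ}
    (h : 0 < d) : ∀ᶠ N in atTop, ∀ j, partialAverage N (R j) ≤ q j + d := by
  -- Rounding `q j` up to the grid of mesh `1 / (k + 1)` costs less than `d / 2`; the other half is
  -- the excess allowed at the finitely many grid points.
  obtain ⟨k, hk⟩ := exists_nat_one_div_lt (half_pos h)
  have hk0 : (0 : ℝ) < (k : ℝ) + 1 := by positivity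
  have hgrid : ∀ i : ℕ, i ≤ k + 1 → ∃ j, (q j : ℝ) = i / ((k : ℝ) + 1) := fun i hi => by
    obtain ⟨j, hj⟩ := hq ((i : ℚ) / ((k : ℚ) + 1)) (by positivity)
      ((div_le_one (by positivity)).2 (by exact_mod_cast hi))
    exact ⟨j, by rw [hj]; push_cast; rfl⟩
  choose! g hg using hgrid
  have hev : ∀ᶠ N in atTop, ∀ i ∈ Finset.range (k + 2),
      partialAverage N (R (g i)) ≤ q (g i) + d / 2 :=
    (Filter.eventually_all_finset _).2 fun i _ => (hd (g i)).eventually_le (by linarith)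
  filter_upwards [hev] with N hN j
  set i := ⌈(q j : ℝ) * ((k : ℝ) + 1)⌉₊
  have hi : i ≤ k + 1 := Nat.ceil_le.2 (by
    push_cast
    exact mul_le_of_le_one_left hk0.le (q j).2.2)
  have h1 : (q j : ℝ) ≤ q (g i) := by
    rw [hg i hi, le_div_iff₀ hk0]
    exact Nat.le_ceil _
  have h2 : (q (g i) : ℝ) ≤ q j + 1 / ((k : ℝ) + 1) := by
    rw [hg i hi, div_le_iff₀ hk0, add_mul, one_div_mul_cancel hk0.ne']
    exact (Nat.ceil_lt_add_one (mul_nonneg (q j).2.1 hk0.le)).le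
  calc partialAverage N (R j) ≤ partialAverage N (R (g i)) := partialAverage_mono N (hR _ _ h1)
    _ ≤ q (g i) + d / 2 := hN i (Finset.mem_range.2 (by omega))
    _ ≤ q j + d := by linarith

/-- A chain modulo null sets that takes every density can be lifted to a chain of sets all of
whose partial averages are bounded by the density. -/
theorem exists_tame_chain {C : unitInterval → Set ℕ+} (hC : ∀ t, HasDensity (C t) t)
    (hmono : ∀ s t, s ≤ t → C s \ C t ∈ nullSets) :
    ∃ E : unitInterval → Set ℕ+, Monotone E ∧ (∀ r, HasDensity (E r) r) ∧
      (∀ r N, partialAverage N (E r) ≤ r) ∧ ∀ r, C r \ E r ∈ nullSets := by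
  obtain ⟨q, hq⟩ := exists_enumeration_rat_unitInterval
  set R := rectify (fun i => C (q i)) fun i => q i
  have hR : ∀ i j, (q i : ℝ) ≤ q j → R i ⊆ R j := fun i j h => rectify_subset h
  have hRC := rectify_equiv (C := fun i => C (q i)) (q := fun i => q i) fun i j h => hmono _ _ h
  have hd : ∀ i, HasDensity (R i) (q i) := fun i => (hC _).congr (hRC i).2 (hRC i).1
  -- An integer `n` of `R i` is admitted only if, from `n` on, all averages exceed their densities
  -- by at most some `d ≤ r - q i`.
  let E : unitInterval → Set ℕ+ := fun r => {n | ∃ (i : ℕ) (d : ℝ), (q i : ℝ) + d ≤ r ∧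
    (∀ M ≥ n, ∀ j, partialAverage M (R j) ≤ q j + d) ∧ n ∈ R i}
  have hE : ∀ r N, partialAverage N (E r) ≤ r := fun r N => by
    classical
    choose! i d h1 h2 h3 using fun (n : ℕ+) (hn : n ∈ E r) => hn
    rcases ((Finset.Icc 1 N).filter (· ∈ E r)).eq_empty_or_nonempty with h | h
    · calc partialAverage N (E r) ≤ partialAverage N ∅ :=
            partialAverage_le_of_forall fun n hn hnE =>
              absurd (Finset.mem_filter.2 ⟨Finset.mem_Icc.2 ⟨one_le, hn⟩, hnE⟩) (by simp [h])
        _ = 0 := partialAverage_empty N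
        _ ≤ r := r.2.1
    -- The element with the largest label decides: up to `N`, all of `E r` lies in `R (i n)`, and `N
    -- ≥ n` makes the bound attached to `n` available.
    · obtain ⟨n, hn, hmax⟩ := Finset.exists_max_image _ (fun n => (q (i n) : ℝ)) h
      obtain ⟨hnN, hnE⟩ := Finset.mem_filter.1 hn
      calc partialAverage N (E r) ≤ partialAverage N (R (i n)) :=
            partialAverage_le_of_forall fun m hm hmE => hR _ _
              (hmax m (Finset.mem_filter.2 ⟨Finset.mem_Icc.2 ⟨one_le, hm⟩, hmE⟩)) (h3 m hmE)
        _ ≤ q (i n) + d n := h2 n hnE N (Finset.mem_Icc.1 hnN).2 _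
        _ ≤ r := h1 n hnE
  have hCE : ∀ r, C r \ E r ∈ nullSets := fun r => by
    refine mem_nullSets_of_forall_pos fun ε hε => ?_
    rcases lt_or_ge (r : ℝ) ε with hr | hr
    · refine ⟨C r, r, hC r, hr, ?_⟩
      exact nullSets_subset empty_mem_nullSets fun n hn => hn.2 hn.1.1
    · obtain ⟨x, hx1, hx2⟩ := exists_rat_btwn (sub_lt_self (r : ℝ) hε)
      obtain ⟨j, hj⟩ := hq x (by exact_mod_cast (sub_nonneg.2 hr).trans hx1.le)
        (by exact_mod_cast hx2.le.trans r.2.2)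
      rw [← hj] at hx1 hx2
      have hle : C (q j) \ C r ∈ nullSets := hmono _ _ hx2.le
      refine ⟨C r \ C (q j), _, (hC _).sdiff (hC r) hle, by linarith, ?_⟩
      have hRE : R j \ E r ∈ nullSets := by
        obtain ⟨m, hm⟩ := eventually_atTop.1
          (eventually_forall_partialAverage_le hq hR hd (sub_pos.2 hx2))
        refine mem_nullSets_of_forall_lt m fun n hn => ?_
        by_contra! h
        -- The full slack `r - q j` is positive, so only finitely many elements of `R j` are
        -- refused.
        exact hn.2 ⟨j, r - q j, by linarith, fun M hM => hm M (le_trans h hM), hn.1⟩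
      refine nullSets_subset (sdiff_trans_mem_nullSets (hRC j).2 hRE) ?_
      rintro n ⟨⟨h1, h2⟩, h3⟩
      exact ⟨by_contra fun h => h3 ⟨h1, h⟩, h2⟩
  refine ⟨E, ?_, fun r => hasDensity_of_forall_pos (fun ε hε => ?_) fun ε hε => ?_, hE, hCE⟩
  · rintro r s hrs n ⟨i, d, h1, h2⟩
    exact ⟨i, d, h1.trans hrs, h2⟩
  · exact ⟨C r, r, hC r, sub_lt_self _ hε, hCE r⟩
  · exact .of_forall fun N => (hE r N).trans (le_add_of_nonneg_right hε.le)

/-! ### Unions and intersections that realize extremal densities. -/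

theorem partialAverage_biUnion_le {E : unitInterval → Set ℕ+} (hmono : Monotone E)
    (hle : ∀ r N, partialAverage N (E r) ≤ r) (S : Set unitInterval) (N : ℕ+) :
    partialAverage N (⋃ r ∈ S, E r) ≤ (sSup S : unitInterval) :=
  have h : ⋃ r ∈ S, E r ⊆ E (sSup S) := Set.iUnion₂_subset fun _ hr => hmono (le_sSup hr)
  (partialAverage_mono N h).trans (hle _ N)

theorem partialAverage_biInter_le {E : unitInterval → Set ℕ+}
    (hle : ∀ r N, partialAverage N (E r) ≤ r) (S : Set unitInterval) (N : ℕ+) :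
    partialAverage N (⋂ r ∈ S, E r) ≤ (sInf S : unitInterval) := by
  have h : (⟨partialAverage N (⋂ r ∈ S, E r), partialAverage_nonneg N _,
      partialAverage_le_one N _⟩ : unitInterval) ≤ sInf S :=
    le_sInf fun r hr => (partialAverage_mono N (Set.biInter_subset_of_mem hr)).trans (hle r N)
  exact h

/-- Since `S` may be empty, with supremum `0` in `[0,1]`, the bound `0 ≤ x` is essential; callers
treat `s < ε` separately. -/
theorem exists_lt_of_isLUB_image {ι : Type*} {a : ι → unitInterval} {S : Set ι}
    {s : unitInterval} (hs : IsLUB (a '' S) s) {x : ℝ} (h0 : 0 ≤ x) (hx : x < s) :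
    ∃ i ∈ S, x < a i := by
  obtain ⟨_, ⟨i, hi, rfl⟩, h⟩ :=
    (lt_isLUB_iff hs).1
    (show (⟨x, h0, hx.le.trans s.2.2⟩ : unitInterval) < s from hx)
  exact ⟨i, hi, h⟩

theorem exists_lt_of_isGLB_image {ι : Type*} {a : ι → unitInterval} {S : Set ι}
    {s : unitInterval} (hs : IsGLB (a '' S) s) {x : ℝ} (h1 : x ≤ 1) (hx : s < x) :
    ∃ i ∈ S, a i < x := by
  obtain ⟨_, ⟨i, hi, rfl⟩, h⟩ :=
    (isGLB_lt_iff hs).1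
    (show s < (⟨x, s.2.1.trans hx.le, h1⟩ : unitInterval) from hx)
  exact ⟨i, hi, h⟩

theorem hasDensity_biUnion {E : unitInterval → Set ℕ+} (hmono : Monotone E)
    (hd : ∀ r, HasDensity (E r) r) (hle : ∀ r N, partialAverage N (E r) ≤ r)
    (S : Set unitInterval) : HasDensity (⋃ r ∈ S, E r) (sSup S : unitInterval) := by
  refine hasDensity_of_forall_pos (fun ε hε => ?_) fun ε hε => .of_forall fun N =>
    (partialAverage_biUnion_le hmono hle S N).trans (le_add_of_nonneg_right hε.le)
  rcases lt_or_ge (((sSup S : unitInterval) : ℝ) - ε) 0 with h | h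
  · exact ⟨∅, 0, hasDensity_empty, h, by simpa using empty_mem_nullSets⟩
  · obtain ⟨r, hr, hlt⟩ := exists_lt_of_isLUB_image (a := id) (S := S)
      (by simpa using isLUB_sSup S) h (sub_lt_self _ hε)
    exact ⟨E r, r, hd r, hlt, sdiff_mem_nullSets_of_subset (Set.subset_biUnion_of_mem hr)⟩

theorem hasDensity_biInter {E : unitInterval → Set ℕ+} (hmono : Monotone E)
    (hd : ∀ r, HasDensity (E r) r) (hle : ∀ r N, partialAverage N (E r) ≤ r)
    (S : Set unitInterval) : HasDensity (⋂ r ∈ S, E r) (sInf S : unitInterval) :=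
  hasDensity_of_forall_pos
    (fun _ hε => ⟨E (sInf S), _, hd _, sub_lt_self _ hε, sdiff_mem_nullSets_of_subset
      (Set.subset_iInter₂ fun _ hr => hmono (sInf_le hr))⟩)
    fun _ hε => .of_forall fun N =>
      (partialAverage_biInter_le hle S N).trans (le_add_of_nonneg_right hε.le)

/-- Unions that realize the suprema of the densities respect inclusion modulo null sets. -/
theorem biUnion_sdiff_biUnion_mem_nullSets {ι : Type*} {S : Set ι} {P Q : ι → Set ℕ+}
    {a : ι → unitInterval} {s : unitInterval} (hP : ∀ i, HasDensity (P i) (a i))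
    (hPQ : ∀ i, P i \ Q i ∈ nullSets) (hs : IsLUB (a '' S) s)
    (h : HasDensity (⋃ i ∈ S, P i) s) : (⋃ i ∈ S, P i) \ (⋃ i ∈ S, Q i) ∈ nullSets := by
  refine mem_nullSets_of_forall_pos fun ε hε => ?_
  rcases lt_or_ge ((s : ℝ) - ε) 0 with hlt | hge
  · refine ⟨_, s, h, by linarith, ?_⟩
    exact nullSets_subset empty_mem_nullSets fun n hn => hn.2 hn.1.1
  · obtain ⟨i, hi, hlt⟩ := exists_lt_of_isLUB_image hs hge (sub_lt_self _ hε)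
    -- The part of the union outside `P i` has density below `ε`, and `P i` is almost contained in
    -- `Q i`.
    refine ⟨_, _, (hP i).sdiff h
      (sdiff_mem_nullSets_of_subset (Set.subset_biUnion_of_mem hi)), by linarith,
      nullSets_subset (hPQ i) ?_⟩
    rintro n ⟨⟨h1, h2⟩, h3⟩
    exact ⟨by_contra fun h => h3 ⟨h1, h⟩, fun h => h2 (Set.mem_biUnion hi h)⟩

theorem biInter_sdiff_biInter_mem_nullSets {ι : Type*} {S : Set ι} {P Q : ι → Set ℕ+}
    {a : ι → unitInterval} {s : unitInterval} (hQ : ∀ i, HasDensity (Q i) (a i))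
    (hPQ : ∀ i, P i \ Q i ∈ nullSets) (hs : IsGLB (a '' S) s)
    (h : HasDensity (⋂ i ∈ S, Q i) s) : (⋂ i ∈ S, P i) \ (⋂ i ∈ S, Q i) ∈ nullSets := by
  refine mem_nullSets_of_forall_pos fun ε hε => ?_
  rcases lt_or_ge 1 ((s : ℝ) + ε) with hlt | hge
  · refine ⟨_, _, h.compl, by linarith, ?_⟩
    exact nullSets_subset empty_mem_nullSets fun n hn => hn.2 hn.1.2
  · obtain ⟨i, hi, hlt⟩ := exists_lt_of_isGLB_image hs hge (lt_add_of_pos_right _ hε)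
    refine ⟨_, _, h.sdiff (hQ i)
      (sdiff_mem_nullSets_of_subset (Set.biInter_subset_of_mem hi)), by linarith,
      nullSets_subset (hPQ i) ?_⟩
    rintro n ⟨⟨h1, h2⟩, h3⟩
    exact ⟨Set.biInter_subset_of_mem hi h1, fun h => h3 ⟨h, h2⟩⟩

/-! ### The star closure of a chain, and the theorem. -/

theorem subset_or_subset_of_mem_starClosure {T : Set (Set ℕ+)} {X A : Set ℕ+}
    (h : ∀ B ∈ T, X ⊆ B ∨ B ⊆ X) (hA : A ∈ starClosure T) : X ⊆ A ∨ A ⊆ X := by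
  rcases hA with ⟨C, hC, rfl⟩ | ⟨C, hC, rfl⟩
  · by_cases hX : ∃ B ∈ C, X ⊆ B
    · obtain ⟨B, hB, hXB⟩ := hX
      exact .inl (hXB.trans (Set.subset_sUnion_of_mem hB))
    · push Not at hX
      exact .inr (Set.sUnion_subset fun B hB => (h B (hC hB)).resolve_left (hX B hB))
  · by_cases hX : ∃ B ∈ C, B ⊆ X
    · obtain ⟨B, hB, hXB⟩ := hX
      exact .inr ((Set.sInter_subset_of_mem hB).trans hXB)
    · push Not at hX
      exact .inl (Set.subset_sInter fun B hB => (h B (hC hB)).resolve_right (hX B hB))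

/-- Comparability is extended from `T` to its closure in one argument at a time. -/
theorem isChain_starClosure {T : Set (Set ℕ+)} (hT : IsChain (· ⊆ ·) T) :
    IsChain (· ⊆ ·) (starClosure T) := fun _ hA _ hB _ =>
  subset_or_subset_of_mem_starClosure (fun _ hC => (subset_or_subset_of_mem_starClosure
    (fun _ hD => hT.total hC hD) hA).symm) hB

end Cesaro

theorem mainTheorem4 (T : Set (Set ℕ+)) (hT : T ⊆ limitSets) (hchain : IsChain (· ⊆ ·) T) :
    ∃ φ : ↥(starClosure T ∩ limitSets) → limitSets,
      -- (1)
      (∀ A, symmDiff (φ A : Set ℕ+) A ∈ nullSets) ∧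
      -- (2)
      (∀ A B : ↥(starClosure T ∩ limitSets), (cls A = cls B ↔ φ A = φ B) ∧
        (cls A < cls B ↔ (φ A : Set ℕ+) ⊂ φ B)) ∧
      -- (3): suprema and infima are taken in the unit interval
      (∀ S : Set ↥(starClosure T ∩ limitSets),
        (∃ h : (⋃ A ∈ S, (φ A : Set ℕ+)) ∈ limitSets,
          IsLUB ((fun A => charge (φ A)) '' S) (charge ⟨_, h⟩)) ∧
        (∃ h : (⋂ A ∈ S, (φ A : Set ℕ+)) ∈ limitSets,
          IsGLB ((fun A => charge (φ A)) '' S) (charge ⟨_, h⟩))) ∧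
      -- (4)
      (∀ A ∈ starClosure (range fun A => (φ A : Set ℕ+)),
        ∃ h : A ∈ limitSets, ∀ N : ℕ+, partialAverage N A ≤ charge ⟨A, h⟩) ∧
      -- (5)
      (∀ ρ : ↥(starClosure T ∩ limitSets) → limitSets,
        (∀ A, symmDiff (ρ A : Set ℕ+) A ∈ nullSets) →
        ∀ S : Set ↥(starClosure T ∩ limitSets),
          ((∃ h : (⋃ A ∈ S, (ρ A : Set ℕ+)) ∈ limitSets,
              IsLUB ((fun A => charge (ρ A)) '' S) (charge ⟨_, h⟩)) →
            symmDiff (⋃ A ∈ S, (φ A : Set ℕ+)) (⋃ A ∈ S, (ρ A : Set ℕ+)) ∈ nullSets) ∧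
          ((∃ h : (⋂ A ∈ S, (ρ A : Set ℕ+)) ∈ limitSets,
              IsGLB ((fun A => charge (ρ A)) '' S) (charge ⟨_, h⟩)) →
            symmDiff (⋂ A ∈ S, (φ A : Set ℕ+)) (⋂ A ∈ S, (ρ A : Set ℕ+)) ∈ nullSets)) := by
  set U := starClosure T ∩ limitSets
  have hU : IsChain (· ⊆ ·) U := (isChain_starClosure hchain).mono inter_subset_left
  obtain ⟨C, hCd, hCmono, hUC⟩ := exists_full_chain inter_subset_right hU
  obtain ⟨E, hmono, hd, hle, hCE⟩ := exists_tame_chain hCd hCmono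
  let c : U → unitInterval := fun A => charge ⟨A, A.2.2⟩
  have hc : ∀ A : U, HasDensity A (c A) := fun A => tendsto_charge ⟨A, A.2.2⟩
  let φ : U → limitSets := fun A => ⟨E (c A), (hd _).mem_limitSets⟩
  have hφ : ∀ A, charge (φ A) = c A := fun A => (hd _).charge_eq _
  have hAE : ∀ A : U, (A : Set ℕ+) \ φ A ∈ nullSets := fun A =>
    sdiff_trans_mem_nullSets (hUC A A.2 _ (hc A)) (hCE _)
  -- Equality of densities reverses the inclusion modulo null sets.
  have hEA : ∀ A : U, (φ A : Set ℕ+) \ A ∈ nullSets := fun A =>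
    (hd _).sdiff_mem_nullSets (hc A) le_rfl (.inr (hAE A))
  have hcls : ∀ A B : U, cls A ≤ cls B ↔ c A ≤ c B := fun A B => by
    rw [cls_le_iff]
    refine ⟨(hc A).le (hc B), fun h => (hc A).sdiff_mem_nullSets (hc B) h ?_⟩
    exact (hU.total A.2 B.2).imp sdiff_mem_nullSets_of_subset sdiff_mem_nullSets_of_subset
  have hsub : ∀ A B : U, (φ A : Set ℕ+) ⊆ φ B ↔ c A ≤ c B := fun A B =>
    ⟨fun h => (hd _).le (hd _) (sdiff_mem_nullSets_of_subset h), fun h => hmono h⟩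
  refine ⟨φ, fun A => nullSets_union (hEA A) (hAE A), fun A B => ⟨?_, ?_⟩, fun S => ⟨?_, ?_⟩, ?_,
    fun ρ hρ S => ?_⟩
  · rw [le_antisymm_iff, hcls, hcls, ← hsub, ← hsub, ← Set.Subset.antisymm_iff, Subtype.coe_inj]
  · rw [lt_iff_le_not_ge, hcls, hcls, ← hsub, ← hsub, Set.ssubset_def]
  · have h := hasDensity_biUnion hmono hd hle (c '' S)
    rw [Set.biUnion_image] at h
    refine ⟨h.mem_limitSets, ?_⟩
    rw [h.charge_eq]
    simp only [hφ]
    exact isLUB_sSup _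
  · have h := hasDensity_biInter hmono hd hle (c '' S)
    rw [Set.biInter_image] at h
    refine ⟨h.mem_limitSets, ?_⟩
    rw [h.charge_eq]
    simp only [hφ]
    exact isGLB_sInf _
  · rintro _ (⟨C, hC, rfl⟩ | ⟨C, hC, rfl⟩)
    -- Every member of `C` is some `E r`, so the union can be indexed by densities.
    · have hS : ⋃₀ C = ⋃ r ∈ {r | E r ∈ C}, E r := by
        refine Set.Subset.antisymm (Set.sUnion_subset fun B hB => ?_)
          (Set.iUnion₂_subset fun r hr => Set.subset_sUnion_of_mem hr)
        obtain ⟨A, rfl⟩ := hC hB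
        exact Set.subset_biUnion_of_mem (s := {r | E r ∈ C}) hB
      have h := hasDensity_biUnion hmono hd hle {r | E r ∈ C}
      rw [hS]
      refine ⟨h.mem_limitSets, fun N => ?_⟩
      rw [h.charge_eq]
      exact partialAverage_biUnion_le hmono hle _ N
    · have hS : ⋂₀ C = ⋂ r ∈ {r | E r ∈ C}, E r := by
        refine Set.Subset.antisymm (Set.subset_iInter₂ fun r hr => Set.sInter_subset_of_mem hr)
          (Set.subset_sInter fun B hB => ?_)
        obtain ⟨A, rfl⟩ := hC hB
        exact Set.biInter_subset_of_mem (s := {r | E r ∈ C}) hB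
      have h := hasDensity_biInter hmono hd hle {r | E r ∈ C}
      rw [hS]
      refine ⟨h.mem_limitSets, fun N => ?_⟩
      rw [h.charge_eq]
      exact partialAverage_biInter_le hle _ N
  · have h1 : ∀ A, (φ A : Set ℕ+) \ ρ A ∈ nullSets := fun A =>
      sdiff_trans_mem_nullSets (hEA A) (nullSets_subset (hρ A) le_sup_right)
    have h2 : ∀ A, (ρ A : Set ℕ+) \ φ A ∈ nullSets := fun A =>
      sdiff_trans_mem_nullSets (nullSets_subset (hρ A) le_sup_left) (hAE A)
    have hρd : ∀ A, HasDensity (ρ A) (c A) := fun A => (hd _).congr (h1 A) (h2 A)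
    have hρc : ∀ A, charge (ρ A) = c A := fun A => (hρd A).charge_eq _
    simp only [hρc]
    constructor
    · rintro ⟨h, hlub⟩
      have hφS := hasDensity_biUnion hmono hd hle (c '' S)
      rw [Set.biUnion_image] at hφS
      exact nullSets_union
        (biUnion_sdiff_biUnion_mem_nullSets (fun A => hd (c A)) h1 (isLUB_sSup _) hφS)
        (biUnion_sdiff_biUnion_mem_nullSets hρd h2 hlub (tendsto_charge ⟨_, h⟩))
    · rintro ⟨h, hglb⟩
      have hφS := hasDensity_biInter hmono hd hle (c '' S)
      rw [Set.biInter_image] at hφS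
      exact nullSets_union
        (biInter_sdiff_biInter_mem_nullSets hρd h1 hglb (tendsto_charge ⟨_, h⟩))
        (biInter_sdiff_biInter_mem_nullSets (fun A => hd (c A)) h2 (isGLB_sInf _) hφS)
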